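/- Let $A$ be an associative unital ring and let $\mathsf{Mod}\,A$ be the category of left $A$-modules. A localizing subcategory of $\mathsf{Mod}\,A$ is a class $\mathsf{N}$ of modules closed under submodules, quotients, extensions and arbitrary direct sums (in particular it contains $0$); its torsion functor is $\Gamma_{\mathsf N} M = \{ m \in M \mid A\cdot m \in \mathsf N\}$. Let $\mathsf{M} = \{\mathsf{M}_q\}_{q\in\mathbb Z}$ be an increasing filtration of $\mathsf{Mod}\,A$ by localizing subcategories which is bounded, i.e. there are integers $q_0 \le q_1$ with $\mathsf M_{q_0-1} = 0$ and $\mathsf M_{q_1} = \mathsf{Mod}\,A$; write $\mathsf M^p := \mathsf M_{-p}$, a decreasing filtration. For $p \le p'$ put $\Gamma_{\mathsf M^p/\mathsf M^{p'}} M := \Gamma_{\mathsf M^p} M / \Gamma_{\mathsf M^{p'}} M$, let $\mathrm R\Gamma_{\mathsf M^p/\mathsf M^{p'}}$ be its right derived functor on $\mathsf D^+(\mathsf{Mod}\,A)$, and let $\mathrm H^n_{\mathsf M^p/\mathsf M^{p'}} := \mathrm H^n \mathrm R\Gamma_{\mathsf M^p/\mathsf M^{p'}}$. For $M \in \mathsf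 D^+(\mathsf{Mod}\,A)$ with bounded below injective resolution $M \to I$, the filtered complex $\{\Gamma_{\mathsf M^p} I\}_p$ gives a spectral sequence with $E_1^{p,q} = \mathrm H^{p+q}_{\mathsf M^p/\mathsf M^{p+1}} M$. The Cousin complex $\mathrm E_{\mathsf M} M$ is the row $q=0$ of its first page: $(\mathrm E_{\mathsf M} M)^p = \mathrm H^p_{\mathsf M^p/\mathsf M^{p+1}} M$, with coboundary $d_1^{p,0}$, the composite of the connecting homomorphism $\mathrm H^p_{\mathsf M^p/\mathsf M^{p+1}} M \to \mathrm H^{p+1}(\Gamma_{\mathsf M^{p+1}} I)$ and the canonical map $\mathrm H^{p+1}(\Gamma_{\mathsf M^{p+1}} I) \to \mathrm H^{p+1}_{\mathsf M^{p+1}/\mathsf M^{p+2}} M$. Let $\mathrm Q$ denote the localization functor from complexes of $A$-modules to the derived category $\mathsf D(\mathsf{Mod}\,A)$. **Theorem.** Let $M \in \mathsf D^{\mathrm b}(\mathsf{Mod}\,A)$ satisfy $\mathrm H^{p+q}_{\mathsf M^p/\mathsf M^{p+1}} M = 0$ for all $q \ne 0$ and all $p$. Then there is an isomorphism $M \cong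 \mathrm Q\,\mathrm E_{\mathsf M} M$ in $\mathsf D(\mathsf{Mod}\,A)$. -/

import Mathlib

open CategoryTheory Limits

universe w u

noncomputable section

namespace Cousin

variable {A : Type u} [Ring A]

/-! ### Localizing subcategories and torsion functors -/

/-- A localizing subcategory (hereditary torsion class) of the category of left `A`-modules:
a class of modules closed under subobjects, quotients, extensions and
arbitrary direct sums. -/
class IsLocalizing (P : ObjectProperty (ModuleCat.{u} A)) : Prop extends P.IsSerreClass where
  isClosedUnderCoproducts (J : Type u) : P.IsClosedUnderColimitsOfShape (Discrete J)

section Torsion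

variable (P Q : ObjectProperty (ModuleCat.{u} A)) [IsLocalizing P] [IsLocalizing Q]

lemma prop_of_le {M : ModuleCat.{u} A} {N N' : Submodule A M} (h : N ≤ N')
    (hN' : P (ModuleCat.of A N')) : P (ModuleCat.of A N) := by
  have : Mono (ModuleCat.ofHom (Submodule.inclusion h)) :=
    (ModuleCat.mono_iff_injective _).2 (Submodule.inclusion_injective h)
  exact P.prop_of_mono (ModuleCat.ofHom (Submodule.inclusion h)) hN'

lemma prop_sup {M : ModuleCat.{u} A} {N N' : Submodule A M}
    (hN : P (ModuleCat.of A N)) (hN' : P (ModuleCat.of A N')) :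
    P (ModuleCat.of A (N ⊔ N' : Submodule A M)) := by
  let f : N →ₗ[A] (N ⊔ N' : Submodule A M) := Submodule.inclusion le_sup_left
  let g : N' →ₗ[A] (N ⊔ N' : Submodule A M) := Submodule.inclusion le_sup_right
  have hfg : Function.Surjective (f.coprod g) := by
    rintro ⟨x, hx⟩
    obtain ⟨y, hy, z, hz, rfl⟩ := Submodule.mem_sup.1 hx
    exact ⟨(⟨y, hy⟩, ⟨z, hz⟩), by ext; simp [f, g]⟩
  have : Epi (ModuleCat.ofHom (f.coprod g)) := (ModuleCat.epi_iff_surjective _).2 hfg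
  have hprod : P (ModuleCat.of A (N × N')) :=
    P.prop_of_iso (ModuleCat.biprodIsoProd (ModuleCat.of A N) (ModuleCat.of A N'))
      (P.prop_biprod hN hN')
  exact P.prop_of_epi (ModuleCat.ofHom (f.coprod g)) hprod

lemma prop_map {M M' : ModuleCat.{u} A} (f : M ⟶ M') {N : Submodule A M}
    (hN : P (ModuleCat.of A N)) : P (ModuleCat.of A (N.map f.hom)) := by
  have : Epi (ModuleCat.ofHom (f.hom.submoduleMap N)) :=
    (ModuleCat.epi_iff_surjective _).2 (f.hom.submoduleMap_surjective N)
  exact P.prop_of_epi (ModuleCat.ofHom (f.hom.submoduleMap N)) hN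

/-- The submodule `Γ_P M = {m ∈ M | A · m ∈ P}` of elements of `M` supported on the localizing
subcategory `P`. -/
def torsion (M : ModuleCat.{u} A) : Submodule A M where
  carrier := {m | P (ModuleCat.of A (Submodule.span A {m}))}
  zero_mem' := P.prop_of_isZero (by
    rw [Submodule.span_zero_singleton]
    exact ModuleCat.isZero_of_subsingleton _)
  add_mem' {x y} hx hy := by
    refine prop_of_le P ?_ (prop_sup P hx hy)
    rw [Submodule.span_singleton_le_iff_mem]
    exact Submodule.add_mem_sup (Submodule.mem_span_singleton_self x)
      (Submodule.mem_span_singleton_self y)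
  smul_mem' a x hx := by
    refine prop_of_le P ?_ hx
    rw [Submodule.span_singleton_le_iff_mem]
    exact Submodule.smul_mem _ a (Submodule.mem_span_singleton_self x)

lemma mem_torsion_iff {M : ModuleCat.{u} A} (m : M) :
    m ∈ torsion P M ↔ P (ModuleCat.of A (Submodule.span A {m})) := Iff.rfl

lemma torsion_le_comap {M N : ModuleCat.{u} A} (f : M ⟶ N) :
    torsion P M ≤ (torsion P N).comap f.hom := by
  intro m hm
  have := prop_map P f hm
  rw [Submodule.map_span, Set.image_singleton] at this
  exact this

variable {P Q} in
lemma torsion_mono (h : P ≤ Q) (M : ModuleCat.{u} A) : torsion P M ≤ torsion Q M :=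
  fun _ hm => h _ hm

/-- The torsion functor `Γ_P : Mod A ⥤ Mod A`. -/
@[simps]
def torsionFunctor : ModuleCat.{u} A ⥤ ModuleCat.{u} A where
  obj M := ModuleCat.of A (torsion P M)
  map f := ModuleCat.ofHom (f.hom.restrict (torsion_le_comap P f))

instance : (torsionFunctor P).Additive where

lemma submoduleOf_le_comap {M N : ModuleCat.{u} A} (f : M ⟶ N) :
    (torsion P M).submoduleOf (torsion Q M) ≤
      ((torsion P N).submoduleOf (torsion Q N)).comap
        (f.hom.restrict (torsion_le_comap Q f)) :=
  fun _ hm => torsion_le_comap P f hm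

/-- The functor `M ↦ Γ_Q M / Γ_P M`, for localizing subcategories `P ⊆ Q`. -/
@[simps]
def torsionQuotient : ModuleCat.{u} A ⥤ ModuleCat.{u} A where
  obj M := ModuleCat.of A (torsion Q M ⧸ (torsion P M).submoduleOf (torsion Q M))
  map f := ModuleCat.ofHom (Submodule.mapQ _ _ (f.hom.restrict (torsion_le_comap Q f))
    (submoduleOf_le_comap P Q f))
  map_id M := by
    ext x
    rfl
  map_comp f g := by
    ext x
    rfl

instance : (torsionQuotient P Q).Additive where
  map_add {M N f g} := by
    ext x
    obtain ⟨x, rfl⟩ := Submodule.Quotient.mk_surjective _ x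
    rfl

variable {P Q} in
/-- The inclusion `Γ_P ⟶ Γ_Q` when `P ⊆ Q`. -/
@[simps]
def torsionInclusion (h : P ≤ Q) : torsionFunctor P ⟶ torsionFunctor Q where
  app M := ModuleCat.ofHom (Submodule.inclusion (torsion_mono h M))

/-- The projection `Γ_Q ⟶ Γ_Q / Γ_P`. -/
@[simps]
def torsionProjection : torsionFunctor Q ⟶ torsionQuotient P Q where
  app M := ModuleCat.ofHom (Submodule.mkQ _)

variable {P Q} in
/-- The sequence `0 ⟶ Γ_P K ⟶ Γ_Q K ⟶ Γ_Q K / Γ_P K ⟶ 0` for a cochain complex `K`. -/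
@[simps]
def torsionSequence (h : P ≤ Q) :
    CochainComplex (ModuleCat.{u} A) ℤ ⥤ ShortComplex (CochainComplex (ModuleCat.{u} A) ℤ) where
  obj K :=
    { X₁ := ((torsionFunctor P).mapHomologicalComplex _).obj K
      X₂ := ((torsionFunctor Q).mapHomologicalComplex _).obj K
      X₃ := ((torsionQuotient P Q).mapHomologicalComplex _).obj K
      f := (NatTrans.mapHomologicalComplex (torsionInclusion h) _).app K
      g := (NatTrans.mapHomologicalComplex (torsionProjection P Q) _).app K
      zero := by
        ext n x
        exact (Submodule.Quotient.mk_eq_zero _).2 x.2 }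
  map φ :=
    { τ₁ := ((torsionFunctor P).mapHomologicalComplex _).map φ
      τ₂ := ((torsionFunctor Q).mapHomologicalComplex _).map φ
      τ₃ := ((torsionQuotient P Q).mapHomologicalComplex _).map φ
      comm₁₂ := ((NatTrans.mapHomologicalComplex (torsionInclusion h) _).naturality φ)
      comm₂₃ := ((NatTrans.mapHomologicalComplex (torsionProjection P Q) _).naturality φ) }

variable {P Q} in
lemma torsionSequence_shortExact (h : P ≤ Q) (K : CochainComplex (ModuleCat.{u} A) ℤ) :
    ((torsionSequence h).obj K).ShortExact := by
  refine HomologicalComplex.shortExact_of_degreewise_shortExact _ fun n => ?_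
  refine ModuleCat.shortComplex_shortExact _ ?_ ?_ ?_
  · intro x
    constructor
    · intro hx
      exact ⟨⟨x.1, (Submodule.Quotient.mk_eq_zero
        ((torsion P (K.X n)).submoduleOf (torsion Q (K.X n)))).1 hx⟩, rfl⟩
    · rintro ⟨y, rfl⟩
      exact (Submodule.Quotient.mk_eq_zero _).2 y.2
  · exact Submodule.inclusion_injective (torsion_mono h (K.X n))
  · exact Submodule.mkQ_surjective _

end Torsion

/-! ### Filtrations by localizing subcategories -/

variable (A) in
/-- An increasing filtration `⋯ ⊆ M_{q-1} ⊆ M_q ⊆ M_{q+1} ⊆ ⋯` of `Mod A` by localizing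
subcategories, indexed by `ℤ`. -/
structure LocalizingFiltration where
  /-- The localizing subcategory `M_q`. -/
  level (q : ℤ) : ObjectProperty (ModuleCat.{u} A)
  isLocalizing (q : ℤ) : IsLocalizing (level q)
  monotone : Monotone level

namespace LocalizingFiltration

variable (F : LocalizingFiltration A)

/-- The filtration is bounded if `M_{q₀ - 1} = 0` and `M_{q₁} = Mod A` for some `q₀ ≤ q₁`. -/
def IsBounded : Prop :=
  ∃ q₀ q₁ : ℤ, q₀ ≤ q₁ ∧ (∀ M : ModuleCat.{u} A, F.level (q₀ - 1) M → IsZero M) ∧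
    ∀ M : ModuleCat.{u} A, F.level q₁ M

/-- The decreasing indexing `M^p := M_{-p}`. -/
def colevel (p : ℤ) : ObjectProperty (ModuleCat.{u} A) := F.level (-p)

instance (p : ℤ) : IsLocalizing (F.colevel p) := F.isLocalizing (-p)

lemma colevel_antitone : Antitone F.colevel := fun _ _ h => F.monotone (neg_le_neg h)

lemma colevel_succ_le (p : ℤ) : F.colevel (p + 1) ≤ F.colevel p :=
  F.colevel_antitone (by lia)

/-- The functor `Γ_{M^p / M^{p'}} = Γ_{M^p} / Γ_{M^{p'}}`, for `p ≤ p'`. -/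
abbrev quotientTorsion (p p' : ℤ) : ModuleCat.{u} A ⥤ ModuleCat.{u} A :=
  torsionQuotient (F.colevel p') (F.colevel p)

section CousinOfComplex

variable (K : CochainComplex (ModuleCat.{u} A) ℤ)

/-- The subcomplex `Γ_{M^p} K`. -/
abbrev torsionComplex (p : ℤ) : CochainComplex (ModuleCat.{u} A) ℤ :=
  ((torsionFunctor (F.colevel p)).mapHomologicalComplex (.up ℤ)).obj K

/-- The graded piece `Γ_{M^p} K / Γ_{M^{p+1}} K`. -/
abbrev gradedComplex (p : ℤ) : CochainComplex (ModuleCat.{u} A) ℤ :=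
  ((F.quotientTorsion p (p + 1)).mapHomologicalComplex (.up ℤ)).obj K

/-- The map `H^p(Γ_{M^p} K) ⟶ H^p(Γ_{M^p} K / Γ_{M^{p+1}} K)` induced by the projection. -/
def rowProjection (p : ℤ) :
    (F.torsionComplex K p).homology p ⟶ (F.gradedComplex K p).homology p :=
  HomologicalComplex.homologyMap ((NatTrans.mapHomologicalComplex
    (torsionProjection (F.colevel (p + 1)) (F.colevel p)) _).app K) p

/-- The connecting homomorphism
`H^p(Γ_{M^p} K / Γ_{M^{p+1}} K) ⟶ H^{p+1}(Γ_{M^{p+1}} K)`. -/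
def rowConnecting (p : ℤ) :
    (F.gradedComplex K p).homology p ⟶ (F.torsionComplex K (p + 1)).homology (p + 1) :=
  (torsionSequence_shortExact (F.colevel_succ_le p) K).δ p (p + 1) rfl

lemma rowProjection_rowConnecting (p : ℤ) :
    F.rowProjection K p ≫ F.rowConnecting K p = 0 :=
  (torsionSequence_shortExact (F.colevel_succ_le p) K).comp_δ p (p + 1) rfl

/-- The boundary `d_1 : E_1^{p,0} ⟶ E_1^{p+1,0}` on the first page of the spectral sequence
of the filtered complex `{Γ_{M^p} K}`. -/
def rowDifferential (p : ℤ) :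
    (F.gradedComplex K p).homology p ⟶ (F.gradedComplex K (p + 1)).homology (p + 1) :=
  F.rowConnecting K p ≫ F.rowProjection K (p + 1)

lemma rowDifferential_comp (p : ℤ) :
    F.rowDifferential K p ≫ F.rowDifferential K (p + 1) = 0 := by
  rw [rowDifferential, rowDifferential, Category.assoc,
    ← Category.assoc (F.rowProjection K (p + 1)), rowProjection_rowConnecting, zero_comp,
    comp_zero]

/-- The row `q = 0` of the first page
`E_1^{p,q} = H^{p+q}(Γ_{M^p} K / Γ_{M^{p+1}} K)` of the spectral sequence of the filtered
complex `{Γ_{M^p} K}`. -/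
def row : CochainComplex (ModuleCat.{u} A) ℤ :=
  CochainComplex.of (fun p => (F.gradedComplex K p).homology p)
    (F.rowDifferential K) (F.rowDifferential_comp K)

lemma row_d (p : ℤ) : (F.row K).d p (p + 1) = F.rowDifferential K p :=
  CochainComplex.of_d (fun p => (F.gradedComplex K p).homology p) (F.rowDifferential K) p

variable {K} {L : CochainComplex (ModuleCat.{u} A) ℤ} (φ : K ⟶ L) (p : ℤ)

/-- The map on `H^p(Γ_{M^p} K / Γ_{M^{p+1}} K)` induced by a morphism of complexes. -/
def rowMap : (F.gradedComplex K p).homology p ⟶ (F.gradedComplex L p).homology p :=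
  HomologicalComplex.homologyMap
    (((F.quotientTorsion p (p + 1)).mapHomologicalComplex (.up ℤ)).map φ) p

lemma rowProjection_naturality :
    F.rowProjection K p ≫ F.rowMap φ p = HomologicalComplex.homologyMap
      (((torsionFunctor (F.colevel p)).mapHomologicalComplex (.up ℤ)).map φ) p ≫
        F.rowProjection L p := by
  rw [rowProjection, rowProjection, rowMap, ← HomologicalComplex.homologyMap_comp,
    ← HomologicalComplex.homologyMap_comp, NatTrans.naturality]

lemma rowConnecting_naturality :
    F.rowMap φ p ≫ F.rowConnecting L p =
      F.rowConnecting K p ≫ HomologicalComplex.homologyMap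
        (((torsionFunctor (F.colevel (p + 1))).mapHomologicalComplex (.up ℤ)).map φ) (p + 1) :=
  (HomologicalComplex.HomologySequence.δ_naturality
    ((torsionSequence (F.colevel_succ_le p)).map φ)
    (torsionSequence_shortExact _ K) (torsionSequence_shortExact _ L) p (p + 1) rfl).symm

lemma rowDifferential_naturality :
    F.rowMap φ p ≫ F.rowDifferential L p = F.rowDifferential K p ≫ F.rowMap φ (p + 1) := by
  rw [rowDifferential, rowDifferential, ← Category.assoc, rowConnecting_naturality,
    Category.assoc, Category.assoc, rowProjection_naturality]

end CousinOfComplex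

/-- `F.row` as a functor. -/
def rowFunctor : CochainComplex (ModuleCat.{u} A) ℤ ⥤ CochainComplex (ModuleCat.{u} A) ℤ where
  obj K := F.row K
  map {K L} φ := CochainComplex.ofHom (X := F.row K) (Y := F.row L) (F.rowMap φ) (fun p => by
    rw [row_d, row_d]
    exact F.rowDifferential_naturality φ p)
  map_id K := by
    ext p : 1
    change HomologicalComplex.homologyMap _ p = 𝟙 _
    rw [CategoryTheory.Functor.map_id, HomologicalComplex.homologyMap_id]
  map_comp f g := by
    ext p : 1
    change HomologicalComplex.homologyMap _ p = HomologicalComplex.homologyMap _ p ≫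
      HomologicalComplex.homologyMap _ p
    rw [Functor.map_comp, HomologicalComplex.homologyMap_comp]

/-- Homotopic morphisms of complexes induce the same morphism on the row. -/
lemma rowFunctor_map_eq_of_homotopy {K L : CochainComplex (ModuleCat.{u} A) ℤ} {f g : K ⟶ L}
    (h : Homotopy f g) : F.rowFunctor.map f = F.rowFunctor.map g := by
  ext p : 1
  change HomologicalComplex.homologyMap _ p = HomologicalComplex.homologyMap _ p
  exact ((F.quotientTorsion p (p + 1)).mapHomotopy h).homologyMap_eq p

/-- The functor on the homotopy category induced by `rowFunctor`. -/
def rowHomotopyFunctor :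
    HomotopyCategory (ModuleCat.{u} A) (.up ℤ) ⥤ CochainComplex (ModuleCat.{u} A) ℤ :=
  CategoryTheory.Quotient.lift _ F.rowFunctor
    (fun _ _ _ _ ⟨h⟩ => F.rowFunctor_map_eq_of_homotopy h)

variable [HasDerivedCategory.{w} (ModuleCat.{u} A)]

/-- The cohomology functor
`H^n_{M^p / M^{p'}} = H^n ∘ R Γ_{M^p / M^{p'}} : D⁺(Mod A) ⥤ Mod A`, for `p ≤ p'`. -/
def cohomology (p p' n : ℤ) :
    DerivedCategory.Plus (ModuleCat.{u} A) ⥤ ModuleCat.{u} A :=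
  (F.quotientTorsion p p').rightDerivedFunctorPlus ⋙ DerivedCategory.Plus.homologyFunctor _ n

/-- The Cousin functor `E_M : D⁺(Mod A) ⥤ C(Mod A)`, sending `M` to the row `q = 0` of the first
page of the spectral sequence of the filtered complex `{Γ_{M^p} I}`, where `M ⟶ I` is an injective
resolution. It is the right derived functor of the functor sending a complex `K` to the
row `q = 0` of the first page of the spectral sequence of `{Γ_{M^p} K}`. -/
def cousin : DerivedCategory.Plus (ModuleCat.{u} A) ⥤ CochainComplex (ModuleCat.{u} A) ℤ :=
  (HomotopyCategory.Plus.ι _ ⋙ F.rowHomotopyFunctor).totalRightDerived DerivedCategory.Plus.Qh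
    (HomotopyCategory.Plus.quasiIso _)

/-- The natural transformation that is part of the data of the right derived functor `F.cousin`. -/
def cousinUnit :
    HomotopyCategory.Plus.ι _ ⋙ F.rowHomotopyFunctor ⟶ DerivedCategory.Plus.Qh ⋙ F.cousin :=
  (HomotopyCategory.Plus.ι _ ⋙ F.rowHomotopyFunctor).totalRightDerivedUnit
    DerivedCategory.Plus.Qh (HomotopyCategory.Plus.quasiIso _)

instance : F.cousin.IsRightDerivedFunctor F.cousinUnit (HomotopyCategory.Plus.quasiIso _) := by
  dsimp only [cousin, cousinUnit]
  infer_instance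

/-- On a bounded below complex `I` of injective modules, the Cousin complex is the row `q = 0`
of the first page of the spectral sequence of `{Γ_{M^p} I}`. -/
def cousinObjIso (I : CochainComplex.Plus (ModuleCat.{u} A)) [∀ n, Injective (I.obj.X n)] :
    F.row I.obj ≅ F.cousin.obj (DerivedCategory.Plus.Q.obj I) :=
  have (n : ℤ) : Injective (((HomotopyCategory.Plus.quotient _).obj I).obj.as.X n) :=
    inferInstanceAs (Injective (I.obj.X n))
  have : IsIso (F.cousinUnit.app ((HomotopyCategory.Plus.quotient _).obj I)) := inferInstance
  @asIso _ _ _ _ (F.cousinUnit.app ((HomotopyCategory.Plus.quotient _).obj I)) this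

end LocalizingFiltration

end Cousin

/-! Replace `M` by a bounded below complex `K` of injectives, filtered by the subcomplexes Γ_{M^p}
K. The hypothesis says that the graded piece of index `p` has cohomology only in degree `p`, so the
first page is concentrated in the row q = 0. To obtain an isomorphism in the derived category, and
not merely on cohomology, the complex `K` and the row are joined by a roof K ← D → row of
quasi-isomorphisms.

Here D is `diagonalComplex`, the step 0 of Deligne's décalage of the filtration: D^n consists of the
x in Γ_{M^n} K^n with dx in Γ_{M^{n+1}} K^{n+1}. Such an x is a cocycle of the graded piece of index
n, and its class gives the map to the row; since x itself is a lift for the connecting homomorphism,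
d_1 of that class is the class of dx.

Both quasi-isomorphisms rest on `exists_sub_d_mem_torsion`: vanishing cohomology of the graded
pieces lets an element be pushed deeper into the filtration by subtracting coboundaries. In degree
n, pieces of index below n move cocycles of K into D (`quasiIso_diagonalInclusion`); pieces of index
above n show that the kernel of D → row is acyclic (`quasiIso_diagonalToRow`). Boundedness makes
each process start from everything or end at zero. -/

namespace CochainComplex

/-! ### Cohomology of complexes of modules in terms of elements -/

variable {A : Type u} [Ring A] {K L : CochainComplex (ModuleCat.{u} A) ℤ}

lemma d_d_apply (i j k : ℤ) (x : K.X i) : K.d j k (K.d i j x) = 0 := by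
  rw [← ConcreteCategory.comp_apply, K.d_comp_d]
  rfl

lemma hom_d_apply (f : K ⟶ L) (i j : ℤ) (x : K.X i) :
    f.f j (K.d i j x) = L.d i j (f.f i x) := by
  rw [← ConcreteCategory.comp_apply, ← ConcreteCategory.comp_apply, f.comm]

lemma exists_iCycles_eq {i j : ℤ} (hij : i + 1 = j) (x : K.X i) (hx : K.d i j x = 0) :
    ∃ z : K.cycles i, K.iCycles i z = x := by
  let f : ModuleCat.of A (LinearMap.ker (K.d i j).hom) ⟶ K.X i :=
    ModuleCat.ofHom (Submodule.subtype _)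
  have hf : f ≫ K.d i j = 0 := by
    ext y
    exact y.2
  refine ⟨K.liftCycles' f j hij hf ⟨x, hx⟩, ?_⟩
  rw [← ConcreteCategory.comp_apply, K.liftCycles_i]
  rfl

lemma iCycles_injective (i : ℤ) : Function.Injective (K.iCycles i) :=
  (ModuleCat.mono_iff_injective _).1 inferInstance

lemma homologyπ_surjective (i : ℤ) : Function.Surjective (K.homologyπ i) :=
  (ModuleCat.epi_iff_surjective _).1 inferInstance

lemma d_iCycles_apply (i j : ℤ) (z : K.cycles i) : K.d i j (K.iCycles i z) = 0 := by
  rw [← ConcreteCategory.comp_apply, K.iCycles_d]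
  rfl

lemma homologyπ_eq_zero_iff {i j : ℤ} (hij : i + 1 = j) (z : K.cycles j) :
    K.homologyπ j z = 0 ↔ ∃ y : K.X i, K.d i j y = K.iCycles j z := by
  constructor
  · intro hz
    have h := (ShortComplex.exact_of_g_is_cokernel (.mk _ _ (K.toCycles_comp_homologyπ i j))
      (K.homologyIsCokernel i j ((ComplexShape.up ℤ).prev_eq' hij)))
    obtain ⟨y, hy⟩ := (ShortComplex.moduleCat_exact_iff _).1 h z hz
    refine ⟨y, ?_⟩
    change K.toCycles i j y = z at hy
    rw [← hy, ← ConcreteCategory.comp_apply, K.toCycles_i]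
  · rintro ⟨y, hy⟩
    have : K.toCycles i j y = z := by
      apply iCycles_injective
      rw [← hy, ← ConcreteCategory.comp_apply, K.toCycles_i]
    rw [← this, ← ConcreteCategory.comp_apply, K.toCycles_comp_homologyπ]
    rfl

lemma exists_d_eq_of_isZero_homology {i j k : ℤ} (hij : i + 1 = j) (hjk : j + 1 = k)
    (h : IsZero (K.homology j)) (x : K.X j) (hx : K.d j k x = 0) : ∃ y : K.X i, K.d i j y = x := by
  obtain ⟨z, rfl⟩ := exists_iCycles_eq hjk x hx
  have := ModuleCat.subsingleton_of_isZero h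
  exact (homologyπ_eq_zero_iff hij z).1 (Subsingleton.elim _ _)

/-- A morphism of complexes of modules is a quasi-isomorphism if it is bijective on cohomology
classes, expressed in terms of representatives. -/
lemma quasiIso_of_cocycles (f : K ⟶ L)
    (hsurj : ∀ i j k : ℤ, i + 1 = j → j + 1 = k → ∀ z : L.X j, L.d j k z = 0 →
      ∃ x : K.X j, K.d j k x = 0 ∧ ∃ y : L.X i, z = f.f j x + L.d i j y)
    (hinj : ∀ i j k : ℤ, i + 1 = j → j + 1 = k → ∀ x : K.X j, K.d j k x = 0 →
      ∀ y : L.X i, L.d i j y = f.f j x → ∃ w : K.X i, K.d i j w = x) :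
    QuasiIso f := by
  refine ⟨fun j => (quasiIsoAt_iff_isIso_homologyMap _ _).2 ?_⟩
  have hij : j - 1 + 1 = j := by lia
  have hπ (z : K.cycles j) : HomologicalComplex.homologyMap f j (K.homologyπ j z) =
      L.homologyπ j (HomologicalComplex.cyclesMap f j z) := by
    rw [← ConcreteCategory.comp_apply, ← ConcreteCategory.comp_apply,
      HomologicalComplex.homologyπ_naturality]
  have hi (z : K.cycles j) : L.iCycles j (HomologicalComplex.cyclesMap f j z) =
      f.f j (K.iCycles j z) := by
    rw [← ConcreteCategory.comp_apply, ← ConcreteCategory.comp_apply,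
      HomologicalComplex.cyclesMap_i]
  rw [ConcreteCategory.isIso_iff_bijective]
  constructor
  · rw [injective_iff_map_eq_zero]
    intro a ha
    obtain ⟨z, rfl⟩ := homologyπ_surjective j a
    rw [hπ, homologyπ_eq_zero_iff hij] at ha
    obtain ⟨y, hy⟩ := ha
    rw [hi] at hy
    exact (homologyπ_eq_zero_iff hij z).2
      (hinj _ _ _ hij rfl _ (d_iCycles_apply j (j + 1) z) y hy)
  · intro b
    obtain ⟨z, rfl⟩ := homologyπ_surjective j b
    obtain ⟨x, hx, y, hy⟩ := hsurj _ _ _ hij rfl _ (d_iCycles_apply j (j + 1) z)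
    obtain ⟨x, rfl⟩ := exists_iCycles_eq rfl x hx
    refine ⟨K.homologyπ j x, ?_⟩
    rw [hπ, ← sub_eq_zero, ← map_sub, homologyπ_eq_zero_iff hij]
    refine ⟨-y, ?_⟩
    rw [map_sub, hi, hy, map_neg]
    abel

/-- A surjective morphism of complexes of modules with acyclic kernel is a quasi-isomorphism. -/
lemma quasiIso_of_surjective (f : K ⟶ L) (hf : ∀ i, Function.Surjective (f.f i))
    (hker : ∀ i j k : ℤ, i + 1 = j → j + 1 = k → ∀ x : K.X j, K.d j k x = 0 → f.f j x = 0 →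
      ∃ y : K.X i, K.d i j y = x ∧ f.f i y = 0) :
    QuasiIso f := by
  refine quasiIso_of_cocycles f ?_ ?_
  · intro i j k hij hjk z hz
    obtain ⟨x, rfl⟩ := hf j z
    -- The coboundary of a lift `x` of the cocycle `z` is a cocycle of the kernel, hence `d y` with
    -- `y` in the kernel; so `x - y` is a cocycle lifting `z`.
    obtain ⟨y, hy, hy'⟩ := hker j k (k + 1) hjk rfl (K.d j k x) (d_d_apply _ _ _ _)
      (by rw [hom_d_apply, hz])
    exact ⟨x - y, by rw [map_sub, hy, sub_self], 0, by rw [map_sub, hy', map_zero]; abel⟩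
  · intro i j k hij hjk x hx y hy
    obtain ⟨y, rfl⟩ := hf i y
    obtain ⟨w, hw, -⟩ := hker i j k hij hjk (x - K.d i j y)
      (by rw [map_sub, hx, d_d_apply, sub_zero]) (by rw [map_sub, hom_d_apply, hy, sub_self])
    exact ⟨y + w, by rw [map_add, hw]; abel⟩

end CochainComplex

/-! ### The two ends of a bounded filtration -/

namespace Cousin.LocalizingFiltration

variable {A : Type u} [Ring A] (F : LocalizingFiltration A)

lemma torsion_colevel_antitone (M : ModuleCat.{u} A) :
    Antitone fun p => torsion (F.colevel p) M :=
  fun _ _ h => torsion_mono (F.colevel_antitone h) M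

variable {F} in
lemma IsBounded.exists_torsion_colevel_eq_top (hF : F.IsBounded) :
    ∃ p₀ : ℤ, ∀ p ≤ p₀, ∀ M : ModuleCat.{u} A, torsion (F.colevel p) M = ⊤ := by
  obtain ⟨q₀, q₁, -, -, h⟩ := hF
  refine ⟨-q₁, fun p hp M => eq_top_iff.2 fun x _ => ?_⟩
  exact F.monotone (show q₁ ≤ -p by lia) _ (h _)

variable {F} in
lemma IsBounded.exists_torsion_colevel_eq_bot (hF : F.IsBounded) :
    ∃ p₁ : ℤ, ∀ p, p₁ ≤ p → ∀ M : ModuleCat.{u} A, torsion (F.colevel p) M = ⊥ := by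
  obtain ⟨q₀, q₁, -, h, -⟩ := hF
  -- From `1 - q₀` on, `-p ≤ q₀ - 1`, so each torsion element spans a zero module.
  refine ⟨1 - q₀, fun p hp M => eq_bot_iff.2 fun x hx => ?_⟩
  have := ModuleCat.subsingleton_of_isZero
    (h _ (F.monotone (show -p ≤ q₀ - 1 by lia) _ ((mem_torsion_iff (F.colevel p) x).1 hx)))
  exact congrArg Subtype.val (Subsingleton.elim
    (⟨x, Submodule.mem_span_singleton_self x⟩ : Submodule.span A {x}) 0)

/-! ### The diagonal subcomplex and its map to the row -/

section

variable (K : CochainComplex (ModuleCat.{u} A) ℤ)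

lemma d_mem_torsion {p i : ℤ} (j : ℤ) {x : K.X i} (hx : x ∈ torsion (F.colevel p) (K.X i)) :
    K.d i j x ∈ torsion (F.colevel p) (K.X j) :=
  torsion_le_comap (F.colevel p) (K.d i j) hx

lemma gradedComplex_d_mk_eq_mk_iff {p i j : ℤ} {x : K.X j} {y : K.X i}
    (hx : x ∈ torsion (F.colevel p) (K.X j)) (hy : y ∈ torsion (F.colevel p) (K.X i)) :
    (F.gradedComplex K p).d i j (Submodule.Quotient.mk ⟨y, hy⟩) = Submodule.Quotient.mk ⟨x, hx⟩ ↔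
      x - K.d i j y ∈ torsion (F.colevel (p + 1)) (K.X j) :=
  eq_comm.trans (Submodule.Quotient.eq
    ((torsion (F.colevel (p + 1)) (K.X j)).submoduleOf (torsion (F.colevel p) (K.X j)))
    (x := ⟨x, hx⟩) (y := ⟨K.d i j y, F.d_mem_torsion K j hy⟩))

/-- The submodule of `x ∈ Γ_{M^n} K^n` such that `d x ∈ Γ_{M^{n+1}} K^{n+1}`. -/
def diagonal (n : ℤ) : Submodule A (K.X n) :=
  torsion (F.colevel n) (K.X n) ⊓
    (torsion (F.colevel (n + 1)) (K.X (n + 1))).comap (K.d n (n + 1)).hom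

variable {K} in
lemma mem_diagonal_iff {n : ℤ} {x : K.X n} :
    x ∈ F.diagonal K n ↔ x ∈ torsion (F.colevel n) (K.X n) ∧
      K.d n (n + 1) x ∈ torsion (F.colevel (n + 1)) (K.X (n + 1)) := Iff.rfl

/-- The condition on `d x` in degree `i` is the torsion condition on the element `d x` in degree `i
+ 1`; the remaining condition follows from d² = 0. -/
lemma diagonal_le_comap_d (i j : ℤ) :
    F.diagonal K i ≤ (F.diagonal K j).comap (K.d i j).hom := by
  intro x hx
  by_cases hij : i + 1 = j
  · subst hij
    refine (F.mem_diagonal_iff (x := K.d i (i + 1) x)).2 ⟨hx.2, ?_⟩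
    rw [CochainComplex.d_d_apply]
    exact zero_mem _
  · rw [K.shape i j hij]
    exact zero_mem (F.diagonal K j)

/-- The subcomplex of `K` which consists in degree `n` of the `x ∈ Γ_{M^n} K^n`
such that `d x ∈ Γ_{M^{n+1}} K^{n+1}`. -/
@[simps]
def diagonalComplex : CochainComplex (ModuleCat.{u} A) ℤ where
  X n := ModuleCat.of A (F.diagonal K n)
  d i j := ModuleCat.ofHom ((K.d i j).hom.restrict (F.diagonal_le_comap_d K i j))
  shape i j hij := by
    ext x
    have h : K.d i j x.1 = 0 := by
      rw [K.shape i j hij]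
      rfl
    exact h
  d_comp_d' i j k _ _ := by
    ext x
    have h : K.d j k (K.d i j x.1) = 0 := CochainComplex.d_d_apply i j k x.1
    exact h

/-- The inclusion of `F.diagonalComplex K` in `K`. -/
@[simps]
def diagonalInclusion : F.diagonalComplex K ⟶ K where
  f n := ModuleCat.ofHom (Submodule.subtype _)

/-- The inclusion of the degree `n` part of `F.diagonalComplex K` in `Γ_{M^n} K^n`. -/
def diagonalToTorsion (n : ℤ) : (F.diagonalComplex K).X n ⟶ (F.torsionComplex K n).X n :=
  ModuleCat.ofHom (Submodule.inclusion inf_le_left)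

/-- The projection of the degree `n` part of `F.diagonalComplex K` to
`Γ_{M^n} K^n / Γ_{M^{n+1}} K^n`. -/
def diagonalToGraded (n : ℤ) : (F.diagonalComplex K).X n ⟶ (F.gradedComplex K n).X n :=
  F.diagonalToTorsion K n ≫ (torsionProjection (F.colevel (n + 1)) (F.colevel n)).app (K.X n)

lemma diagonalToGraded_d (n : ℤ) :
    F.diagonalToGraded K n ≫ (F.gradedComplex K n).d n (n + 1) = 0 := by
  ext x
  exact (Submodule.Quotient.mk_eq_zero _).2 x.2.2

/-- The map from the degree `n` part of `F.diagonalComplex K` to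
`H^n(Γ_{M^n} K / Γ_{M^{n+1}} K)` sending an element to its cohomology class. -/
def diagonalToRowX (n : ℤ) : (F.diagonalComplex K).X n ⟶ (F.gradedComplex K n).homology n :=
  (F.gradedComplex K n).liftCycles (F.diagonalToGraded K n) (n + 1)
    ((ComplexShape.up ℤ).next_eq' rfl)
    (F.diagonalToGraded_d K n) ≫ (F.gradedComplex K n).homologyπ n

/-- The differential of `F.diagonalComplex K`, with values in `Γ_{M^{n+1}} K^{n+1}`. -/
def diagonalD (n : ℤ) : (F.diagonalComplex K).X n ⟶ (F.torsionComplex K (n + 1)).X (n + 1) :=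
  (F.diagonalComplex K).d n (n + 1) ≫ F.diagonalToTorsion K (n + 1)

lemma diagonalD_d (n : ℤ) :
    F.diagonalD K n ≫ (F.torsionComplex K (n + 1)).d (n + 1) (n + 1 + 1) = 0 := by
  ext x
  exact Subtype.ext (CochainComplex.d_d_apply n (n + 1) (n + 1 + 1) x.1)

/-- In the snake construction `x` serves as its own lift to Γ_{M^n} K, and `d x` already lies in
Γ_{M^{n+1}} K, so it represents the image. -/
lemma diagonalToRowX_rowConnecting (n : ℤ) :
    F.diagonalToRowX K n ≫ F.rowConnecting K n =
      (F.torsionComplex K (n + 1)).liftCycles (F.diagonalD K n) (n + 1 + 1)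
        ((ComplexShape.up ℤ).next_eq' rfl) (F.diagonalD_d K n) ≫
          (F.torsionComplex K (n + 1)).homologyπ (n + 1) :=
  (Category.assoc _ _ _).trans
    ((torsionSequence_shortExact (F.colevel_succ_le n) K).δ_eq n (n + 1) rfl
      (F.diagonalToGraded K n) (F.diagonalToGraded_d K n) (F.diagonalToTorsion K n) rfl
      (F.diagonalD K n) rfl (n + 1 + 1) ((ComplexShape.up ℤ).next_eq' rfl))

lemma diagonalToRowX_rowDifferential (n : ℤ) :
    F.diagonalToRowX K n ≫ F.rowDifferential K n =
      (F.diagonalComplex K).d n (n + 1) ≫ F.diagonalToRowX K (n + 1) := by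
  rw [rowDifferential, ← Category.assoc, diagonalToRowX_rowConnecting, Category.assoc,
    rowProjection, HomologicalComplex.homologyπ_naturality, ← Category.assoc,
    HomologicalComplex.liftCycles_comp_cyclesMap, diagonalToRowX, ← Category.assoc,
    HomologicalComplex.comp_liftCycles]
  rfl

/-- The morphism from `F.diagonalComplex K` to the row `q = 0` of the first page of the spectral
sequence of `{Γ_{M^p} K}` which sends an element to its cohomology class. -/
def diagonalToRow : F.diagonalComplex K ⟶ F.row K where
  f n := F.diagonalToRowX K n
  comm' i j hij := by
    obtain rfl : i + 1 = j := hij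
    rw [row_d]
    exact F.diagonalToRowX_rowDifferential K i

/-- Being a cocycle modulo Γ_{M^{n+1}} is precisely the condition that defines the diagonal, so any
representative will do. -/
lemma exists_diagonalToGraded_eq {n : ℤ} (z : (F.gradedComplex K n).X n)
    (hz : (F.gradedComplex K n).d n (n + 1) z = 0) :
    ∃ x : (F.diagonalComplex K).X n, F.diagonalToGraded K n x = z := by
  obtain ⟨⟨x, hx⟩, rfl⟩ := Submodule.mkQ_surjective _ z
  have h := (F.gradedComplex_d_mk_eq_mk_iff K (zero_mem _) hx).1 hz
  rw [zero_sub, neg_mem_iff] at h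
  exact ⟨⟨x, hx, h⟩, rfl⟩

lemma diagonalToRowX_surjective (n : ℤ) : Function.Surjective (F.diagonalToRowX K n) := by
  intro a
  obtain ⟨z, rfl⟩ := CochainComplex.homologyπ_surjective n a
  obtain ⟨x, hx⟩ := F.exists_diagonalToGraded_eq K _ (CochainComplex.d_iCycles_apply n (n + 1) z)
  refine ⟨x, ?_⟩
  rw [diagonalToRowX, ConcreteCategory.comp_apply]
  congr 1
  apply CochainComplex.iCycles_injective
  rw [← ConcreteCategory.comp_apply, HomologicalComplex.liftCycles_i, hx]

lemma diagonalToRowX_eq_zero_iff {m n : ℤ} (hmn : m + 1 = n) (x : (F.diagonalComplex K).X n) :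
    F.diagonalToRowX K n x = 0 ↔ ∃ y ∈ torsion (F.colevel n) (K.X m),
      x.1 - K.d m n y ∈ torsion (F.colevel (n + 1)) (K.X n) := by
  rw [diagonalToRowX, ConcreteCategory.comp_apply, CochainComplex.homologyπ_eq_zero_iff hmn,
    ← ConcreteCategory.comp_apply, HomologicalComplex.liftCycles_i]
  constructor
  · rintro ⟨y, hy⟩
    obtain ⟨⟨y, hy'⟩, rfl⟩ := Submodule.mkQ_surjective _ y
    exact ⟨y, hy', (F.gradedComplex_d_mk_eq_mk_iff K x.2.1 hy').1 hy⟩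
  · rintro ⟨y, hy, h⟩
    exact ⟨Submodule.Quotient.mk ⟨y, hy⟩, (F.gradedComplex_d_mk_eq_mk_iff K x.2.1 hy).2 h⟩

/-! ### Pushing elements down the filtration, and the two quasi-isomorphisms -/

variable {F K}

/-- By `hdx`, `x` is a cocycle in the graded piece of index `p`; the vanishing makes it a coboundary
there, and `y` lifts a primitive. -/
lemma exists_sub_d_mem_torsion_succ {p i j : ℤ} (hij : i + 1 = j)
    (h : IsZero ((F.gradedComplex K p).homology j)) {x : K.X j}
    (hx : x ∈ torsion (F.colevel p) (K.X j))
    (hdx : K.d j (j + 1) x ∈ torsion (F.colevel (p + 1)) (K.X (j + 1))) :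
    ∃ y ∈ torsion (F.colevel p) (K.X i), x - K.d i j y ∈ torsion (F.colevel (p + 1)) (K.X j) := by
  obtain ⟨y, hy⟩ := CochainComplex.exists_d_eq_of_isZero_homology hij rfl h
    (Submodule.Quotient.mk ⟨x, hx⟩) ((Submodule.Quotient.mk_eq_zero _).2 hdx)
  obtain ⟨⟨y, hy'⟩, rfl⟩ := Submodule.mkQ_surjective _ y
  exact ⟨y, hy', (F.gradedComplex_d_mk_eq_mk_iff K hx hy').1 hy⟩

/-- Iteration of the one-step correction: subtracting a coboundary does not change `d x`, so the
hypothesis on `d x` survives each step. -/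
lemma exists_sub_d_mem_torsion {p p' i j : ℤ} (hpp' : p ≤ p') (hij : i + 1 = j)
    (h : ∀ s, p ≤ s → s < p' → IsZero ((F.gradedComplex K s).homology j)) {x : K.X j}
    (hx : x ∈ torsion (F.colevel p) (K.X j))
    (hdx : K.d j (j + 1) x ∈ torsion (F.colevel p') (K.X (j + 1))) :
    ∃ y ∈ torsion (F.colevel p) (K.X i), x - K.d i j y ∈ torsion (F.colevel p') (K.X j) := by
  induction p', hpp' using Int.leInduction with
  | base => exact ⟨0, zero_mem _, by simpa using hx⟩
  | succ r hr ih =>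
    obtain ⟨y, hy, hxy⟩ := ih (fun s hs hs' => h s hs (by lia))
      (F.torsion_colevel_antitone _ (by lia) hdx)
    obtain ⟨w, hw, hxw⟩ := exists_sub_d_mem_torsion_succ hij (h r hr (by lia)) hxy
      (by rwa [map_sub, CochainComplex.d_d_apply, sub_zero])
    refine ⟨y + w, add_mem hy (F.torsion_colevel_antitone _ hr hw), ?_⟩
    rwa [map_add, ← sub_sub]

lemma quasiIso_diagonalInclusion (hF : F.IsBounded)
    (h : ∀ p n : ℤ, n ≠ p → IsZero ((F.gradedComplex K p).homology n)) :
    QuasiIso (F.diagonalInclusion K) := by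
  obtain ⟨p₀, hp₀⟩ := hF.exists_torsion_colevel_eq_top
  refine CochainComplex.quasiIso_of_cocycles _ ?_ ?_
  · rintro i j _ hij rfl z hz
    -- Level `min p₀ j` is all of `K`, so `z` starts there; only indices `s < j` are crossed on the
    -- way to level `j`, and these have no cohomology in degree `j`.
    obtain ⟨y, -, hy⟩ := exists_sub_d_mem_torsion (p := min p₀ j) (p' := j) (min_le_right _ _) hij
      (fun s _ hs => h s j (by lia)) (x := z)
      (by rw [hp₀ _ (min_le_left _ _)]; trivial) (by rw [hz]; exact zero_mem _)
    have hd : K.d j (j + 1) (z - K.d i j y) = 0 := by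
      rw [map_sub, hz, CochainComplex.d_d_apply, sub_zero]
    exact ⟨⟨z - K.d i j y, F.mem_diagonal_iff.2 ⟨hy, by rw [hd]; exact zero_mem _⟩⟩,
      Subtype.ext hd, y, (sub_add_cancel z _).symm⟩
  · rintro i _ k rfl rfl ⟨x, hx⟩ - y hy
    replace hy : K.d i (i + 1) y = x := hy
    -- The primitive `y` need not lie in the diagonal; it is moved into level `i` by a coboundary,
    -- which leaves `d y = x` unchanged.
    obtain ⟨w, -, hw⟩ := exists_sub_d_mem_torsion (p := min p₀ i) (p' := i) (min_le_right _ _)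
      (sub_add_cancel i 1) (fun s _ hs => h s i (by lia)) (x := y)
      (by rw [hp₀ _ (min_le_left _ _)]; trivial)
      (by rw [hy]; exact F.torsion_colevel_antitone _ (by lia) hx.1)
    have hd : K.d i (i + 1) (y - K.d (i - 1) i w) = x := by
      rw [map_sub, hy, CochainComplex.d_d_apply, sub_zero]
    exact ⟨⟨y - K.d (i - 1) i w, F.mem_diagonal_iff.2 ⟨hw, by rw [hd]; exact hx.1⟩⟩,
      Subtype.ext hd⟩

lemma quasiIso_diagonalToRow (hF : F.IsBounded)
    (h : ∀ p n : ℤ, n ≠ p → IsZero ((F.gradedComplex K p).homology n)) :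
    QuasiIso (F.diagonalToRow K) := by
  obtain ⟨p₁, hp₁⟩ := hF.exists_torsion_colevel_eq_bot
  refine CochainComplex.quasiIso_of_surjective _ (F.diagonalToRowX_surjective K) ?_
  rintro i _ _ rfl rfl ⟨x, hx⟩ hdx hx0
  replace hdx : K.d (i + 1) (i + 1 + 1) x = 0 := congrArg Subtype.val hdx
  obtain ⟨y, hy, hxy⟩ := (F.diagonalToRowX_eq_zero_iff K rfl _).1 hx0
  replace hxy : x - K.d i (i + 1) y ∈ torsion (F.colevel (i + 1 + 1)) (K.X (i + 1)) := hxy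
  -- The cocycle `x - d y` is pushed from level `i + 2` to a level that is zero, crossing only
  -- indices above its degree `i + 1`; hence `x = d (y + w)` exactly.
  obtain ⟨w, hw, hxw⟩ := exists_sub_d_mem_torsion (le_max_left (i + 1 + 1) p₁) rfl
    (fun s hs _ => h s (i + 1) (by lia)) hxy
    (by rw [map_sub, hdx, CochainComplex.d_d_apply, sub_zero]; exact zero_mem _)
  rw [hp₁ _ (le_max_right _ _), Submodule.mem_bot] at hxw
  have hyw : y + w ∈ torsion (F.colevel (i + 1)) (K.X i) :=
    add_mem hy (F.torsion_colevel_antitone _ (by lia) hw)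
  have hd : K.d i (i + 1) (y + w) = x := by
    rw [map_add, eq_comm, ← sub_eq_zero, ← hxw]
    abel
  refine ⟨⟨y + w, F.mem_diagonal_iff.2 ⟨F.torsion_colevel_antitone _ (by lia) hyw,
    by rw [hd]; exact hx.1⟩⟩, Subtype.ext hd, ?_⟩
  -- The primitive `y + w` has degree `i` but lies in level `i + 1`, so it vanishes in the graded
  -- piece of index `i` with no correction.
  refine (F.diagonalToRowX_eq_zero_iff K (sub_add_cancel i 1) _).2 ⟨0, zero_mem _, ?_⟩
  rwa [map_zero, sub_zero]

end

/-! ### Passage to the derived category -/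

section

variable [HasDerivedCategory.{w} (ModuleCat.{u} A)]

/-- The cohomology `H^n_{M^p / M^{p'}}` of a bounded below complex `I` of injective modules is the
cohomology of `Γ_{M^p} I / Γ_{M^{p'}} I`. -/
def cohomologyObjIso (p p' n : ℤ) (I : CochainComplex.Plus (ModuleCat.{u} A))
    [∀ n, Injective (I.obj.X n)] :
    (F.cohomology p p' n).obj (DerivedCategory.Plus.Q.obj I) ≅
      (((F.quotientTorsion p p').mapHomologicalComplex (.up ℤ)).obj I.obj).homology n :=
  have (n : ℤ) : Injective (((HomotopyCategory.Plus.quotient _).obj I).obj.as.X n) :=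
    inferInstanceAs (Injective (I.obj.X n))
  -- Right derived functors are computed by bounded below complexes of injectives: the unit is
  -- invertible there.
  have : IsIso ((F.quotientTorsion p p').rightDerivedFunctorPlusUnit.app
    ((HomotopyCategory.Plus.quotient _).obj I)) := inferInstance
  (DerivedCategory.Plus.homologyFunctor _ n).mapIso
      (@asIso _ _ _ _ ((F.quotientTorsion p p').rightDerivedFunctorPlusUnit.app
        ((HomotopyCategory.Plus.quotient _).obj I)) this).symm ≪≫
    (DerivedCategory.homologyFunctor _ n).mapIso
      ((DerivedCategory.quotientCompQhIso _).app
        (((F.quotientTorsion p p').mapHomologicalComplex (.up ℤ)).obj I.obj)) ≪≫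
    (DerivedCategory.homologyFunctorFactors _ n).app _

/-- If a bounded filtration is such that `Γ_{M^p} K / Γ_{M^{p+1}} K` has cohomology only in
degree `p` for all `p`, then `K` is isomorphic in the derived category to the row `q = 0` of the
first page of the spectral sequence of `{Γ_{M^p} K}`. -/
lemma nonempty_iso_Q_obj_row (hF : F.IsBounded) (K : CochainComplex (ModuleCat.{u} A) ℤ)
    (h : ∀ p n : ℤ, n ≠ p → IsZero ((F.gradedComplex K p).homology n)) :
    Nonempty (DerivedCategory.Q.obj K ≅ DerivedCategory.Q.obj (F.row K)) := by
  have := quasiIso_diagonalInclusion hF h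
  have := quasiIso_diagonalToRow hF h
  exact ⟨(asIso (DerivedCategory.Q.map (F.diagonalInclusion K))).symm ≪≫
    asIso (DerivedCategory.Q.map (F.diagonalToRow K))⟩

end

end Cousin.LocalizingFiltration

theorem theorem2p1 {A : Type u} [Ring A] [HasDerivedCategory.{w} (ModuleCat.{u} A)]
    (F : Cousin.LocalizingFiltration A) (hF : F.IsBounded)
    (M : DerivedCategory (ModuleCat.{u} A)) (hM : DerivedCategory.TStructure.t.bounded M)
    (hCM : ∀ p q : ℤ, q ≠ 0 → IsZero ((F.cohomology p (p + 1) (p + q)).obj ⟨M, hM.1⟩)) :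
    Nonempty (M ≅ DerivedCategory.Q.obj (F.cousin.obj ⟨M, hM.1⟩)) := by
  obtain ⟨n, hn⟩ := hM.1
  have : DerivedCategory.Plus.IsGE ⟨M, hM.1⟩ n := ⟨hn.ge⟩
  obtain ⟨I, -, ⟨e⟩⟩ := DerivedCategory.Plus.exists_injective_nonempty_iso
    (⟨M, hM.1⟩ : DerivedCategory.Plus (ModuleCat.{u} A)) n
  let J := (InjectiveObject.ι (ModuleCat.{u} A)).mapCochainComplexPlus.obj I
  have hJ (n : ℤ) : Injective (J.obj.X n) := (I.obj.X n).property
  obtain ⟨e'⟩ := F.nonempty_iso_Q_obj_row hF J.obj fun p n hnp => by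
    -- Taking `q = n - p` turns the total degree `p + q` into `n`.
    have h := hCM p (n - p) (sub_ne_zero.2 hnp)
    rw [add_sub_cancel] at h
    exact h.of_iso ((F.cohomologyObjIso p (p + 1) n J).symm ≪≫
      (F.cohomology p (p + 1) n).mapIso e)
  -- The chain runs from `M` to its resolution `J`, to the row of `J`, to the Cousin complex of `J`,
  -- and back along `e` to that of `M`.
  exact ⟨DerivedCategory.Plus.ι.mapIso e.symm ≪≫
    (DerivedCategory.quotientCompQhIso _).app J.obj ≪≫ e' ≪≫
    DerivedCategory.Q.mapIso (F.cousinObjIso J ≪≫ F.cousin.mapIso e)⟩
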